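/- Let $\mathbb{C}_+=\{z\in\mathbb{C}:\Im z>0\}$, let $\phi(x)=\frac{1}{\sqrt{2\pi}}e^{-x^2/2}$, and for $z\in\mathbb{C}_+$ let $$s(z)=\int_{-\infty}^{\infty}\frac{\phi(x)}{x-z}\,dx$$ be the Stieltjes transform of the standard normal distribution. Let $m$ be the Stieltjes transform of the free additive convolution of the semicircle law with the standard normal distribution, that is, the unique function $m:\mathbb{C}_+\to\mathbb{C}$ with $\Im m\ge 0$ that satisfies $$m(z)=\int_{-\infty}^{\infty}\frac{\phi(x)}{x-z-m(z)}\,dx\quad(z\in\mathbb{C}_+),\qquad z\,m(z)\to-1\ \text{ as } |z|\to\infty \text{ in } \mathbb{C}_+ .$$ For $\delta\in(0,1)$ and an integer $n\ge1$ put $$\tilde S_\delta=\tilde S_\delta(n)=\Big\{z\in\mathbb{C}_+:\ \sqrt{(2-\delta)\log n}\le \Re z\le\sqrt{3\log n},\ \ \Im z=n^{-1/4}\Big\}.$$ **Theorem (Stability).** For every $\delta\in(0,1)$ there is a constant $C>0$, depending only on $\delta$, such that the following holds. Let $(\varepsilon_n)$ be a sequence of complex numbers with $|\varepsilon_n|\le1$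 for all $n$ and $\varepsilon_n\to0$. Let $n>C$, let $z\in\tilde S_\delta(n)$, and let $\tilde m_n\in\mathbb{C}$ with $\Im\tilde m_n\ge0$ satisfy $$\tilde m_n=s(z+\tilde m_n)+\varepsilon_n .$$ Then $|m(z)-\tilde m_n|\le C\,|\varepsilon_n|$. -/

import Mathlib

open MeasureTheory Filter Topology

namespace GaussFC

/-- The density of the standard normal distribution. -/
noncomputable def phi (x : ℝ) : ℝ := (1 / Real.sqrt (2 * Real.pi)) * Real.exp (-x ^ 2 / 2)

/-- The Stieltjes transform of the standard normal distribution (used for `0 < z.im`). -/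
noncomputable def s (z : ℂ) : ℂ := ∫ x : ℝ, (phi x : ℂ) / ((x : ℂ) - z)

/-- `m` is the Stieltjes transform of the free convolution of the semicircle law with the standard
normal law: it has nonnegative imaginary part, it solves the fixed point equation
`m z = ∫ phi x / (x - z - m z) dx` on the upper half-plane, and `z * m z → -1` as `|z| → ∞`
in the upper half-plane. -/
structure IsFreeConvTransform (m : UpperHalfPlane → ℂ) : Prop where
  im_nonneg : ∀ z, 0 ≤ (m z).im
  fixed_point : ∀ z : UpperHalfPlane,
    m z = ∫ x : ℝ, (phi x : ℂ) / ((x : ℂ) - (z : ℂ) - m z)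
  normalized : Tendsto (fun z : UpperHalfPlane => (z : ℂ) * m z)
    (comap (fun z : UpperHalfPlane => ‖(z : ℂ)‖) atTop) (𝓝 (-1))

lemma phi_nonneg (x : ℝ) : 0 ≤ phi x := by unfold phi; positivity

lemma phi_eq (x : ℝ) : phi x = (1 / Real.sqrt (2 * Real.pi)) * Real.exp (-(1 / 2) * x ^ 2) := by
  unfold phi; congr 2; ring

lemma continuous_phi : Continuous phi := by unfold phi; fun_prop

lemma integrable_phi : Integrable phi := by
  have h := (integrable_exp_neg_mul_sq (b := 1 / 2) (by norm_num)).const_mul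
    (1 / Real.sqrt (2 * Real.pi))
  exact h.congr (Eventually.of_forall fun x => (phi_eq x).symm)

lemma integral_phi : ∫ x, phi x = 1 := by
  simp_rw [phi_eq]
  rw [integral_const_mul, integral_gaussian]
  have : Real.pi / (1 / 2) = 2 * Real.pi := by ring
  rw [this]
  have : Real.sqrt (2 * Real.pi) ≠ 0 := by positivity
  field_simp

lemma sub_ne {z : ℂ} (hz : 0 < z.im) (x : ℝ) : (x : ℂ) - z ≠ 0 := by
  intro h
  have := congrArg Complex.im h
  simp at this
  linarith

lemma im_le_norm_sub {z : ℂ} (hz : 0 < z.im) (x : ℝ) : z.im ≤ ‖(x : ℂ) - z‖ := by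
  have := Complex.abs_im_le_norm ((x : ℂ) - z)
  simp at this
  rwa [abs_of_pos hz] at this

lemma norm_inv_le {z : ℂ} (hz : 0 < z.im) (x : ℝ) : ‖((x : ℂ) - z)⁻¹‖ ≤ z.im⁻¹ := by
  rw [norm_inv]
  exact inv_anti₀ hz (im_le_norm_sub hz x)

lemma continuous_inv {z : ℂ} (hz : 0 < z.im) : Continuous fun x : ℝ => ((x : ℂ) - z)⁻¹ :=
  Continuous.inv₀ (by fun_prop) (sub_ne hz)

lemma integrable_s {z : ℂ} (hz : 0 < z.im) :
    Integrable fun x : ℝ => (phi x : ℂ) / ((x : ℂ) - z) := by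
  simp_rw [div_eq_mul_inv]
  exact integrable_phi.ofReal.mul_bdd (c := z.im⁻¹) (continuous_inv hz).aestronglyMeasurable
    (Eventually.of_forall (norm_inv_le hz))

/-- The integral of `phi x * (1 / |x - a|) * (1 / |x - b|)`. -/
noncomputable def J (a b : ℂ) : ℝ := ∫ x : ℝ, phi x * (‖((x : ℂ) - a)⁻¹‖ * ‖((x : ℂ) - b)⁻¹‖)

lemma integrable_J {a b : ℂ} (ha : 0 < a.im) (hb : 0 < b.im) :
    Integrable fun x : ℝ => phi x * (‖((x : ℂ) - a)⁻¹‖ * ‖((x : ℂ) - b)⁻¹‖) := by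
  refine integrable_phi.mul_bdd (c := a.im⁻¹ * b.im⁻¹)
    ((continuous_inv ha).norm.mul (continuous_inv hb).norm).aestronglyMeasurable
    (Eventually.of_forall fun x => ?_)
  rw [norm_mul, norm_norm, norm_norm]
  exact mul_le_mul (norm_inv_le ha x) (norm_inv_le hb x) (norm_nonneg _) (by positivity)

lemma J_nonneg (a b : ℂ) : 0 ≤ J a b :=
  integral_nonneg fun x => mul_nonneg (phi_nonneg x) (by positivity)

lemma J_le {a b : ℂ} (ha : 0 < a.im) (hb : 0 < b.im) : J a b ≤ a.im⁻¹ * b.im⁻¹ := by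
  calc J a b ≤ ∫ x, phi x * (a.im⁻¹ * b.im⁻¹) := by
        refine integral_mono (integrable_J ha hb) (integrable_phi.mul_const _) fun x => ?_
        exact mul_le_mul_of_nonneg_left
          (mul_le_mul (norm_inv_le ha x) (norm_inv_le hb x) (norm_nonneg _) (by positivity))
          (phi_nonneg x)
    _ = _ := by rw [integral_mul_const, integral_phi, one_mul]

lemma J_sq_le {a b : ℂ} (ha : 0 < a.im) (hb : 0 < b.im) : J a b ^ 2 ≤ J a a * J b b := by
  have key : ∀ t : ℝ, 0 ≤ J a a * (t * t) + (-2 * J a b) * t + J b b := by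
    intro t
    have h : J a a * (t * t) + (-2 * J a b) * t + J b b =
        ∫ x : ℝ, phi x * (t * ‖((x : ℂ) - a)⁻¹‖ - ‖((x : ℂ) - b)⁻¹‖) ^ 2 := by
      have e : (fun x : ℝ => phi x * (t * ‖((x : ℂ) - a)⁻¹‖ - ‖((x : ℂ) - b)⁻¹‖) ^ 2) =
          fun x : ℝ => (phi x * (‖((x : ℂ) - a)⁻¹‖ * ‖((x : ℂ) - a)⁻¹‖) * (t * t)
            + phi x * (‖((x : ℂ) - a)⁻¹‖ * ‖((x : ℂ) - b)⁻¹‖) * (-2 * t))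
            + phi x * (‖((x : ℂ) - b)⁻¹‖ * ‖((x : ℂ) - b)⁻¹‖) := by
        funext x; ring
      have hi : Integrable fun x : ℝ => phi x * (‖((x : ℂ) - a)⁻¹‖ * ‖((x : ℂ) - a)⁻¹‖) * (t * t)
          + phi x * (‖((x : ℂ) - a)⁻¹‖ * ‖((x : ℂ) - b)⁻¹‖) * (-2 * t) :=
        ((integrable_J ha ha).mul_const _).add ((integrable_J ha hb).mul_const _)
      rw [e, integral_add hi (integrable_J hb hb),
        integral_add ((integrable_J ha ha).mul_const _) ((integrable_J ha hb).mul_const _),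
        integral_mul_const, integral_mul_const]
      unfold J
      ring
    rw [h]
    exact integral_nonneg fun x => mul_nonneg (phi_nonneg x) (sq_nonneg _)
  have := discrim_le_zero key
  unfold discrim at this
  nlinarith

lemma im_s {z : ℂ} (hz : 0 < z.im) : (s z).im = z.im * J z z := by
  have h := integral_im (𝕜 := ℂ) (integrable_s hz)
  simp only [RCLike.im_to_complex] at h
  unfold s J
  rw [← h, ← integral_const_mul]
  congr 1
  funext x
  rw [div_eq_mul_inv, Complex.im_ofReal_mul, Complex.inv_im, norm_inv, Complex.normSq_eq_norm_sq]
  simp only [Complex.sub_im, Complex.ofReal_im, zero_sub, neg_neg]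
  have : ‖(x : ℂ) - z‖ ≠ 0 := norm_ne_zero_iff.mpr (sub_ne hz x)
  field_simp

lemma norm_s_sub_le {a b : ℂ} (ha : 0 < a.im) (hb : 0 < b.im) :
    ‖s a - s b‖ ≤ ‖a - b‖ * J a b := by
  unfold s J
  rw [← integral_sub (integrable_s ha) (integrable_s hb), ← integral_const_mul]
  refine norm_integral_le_of_norm_le ((integrable_J ha hb).const_mul _)
    (Eventually.of_forall fun x => le_of_eq ?_)
  have h1 := sub_ne ha x
  have h2 := sub_ne hb x
  have : (phi x : ℂ) / ((x : ℂ) - a) - (phi x : ℂ) / ((x : ℂ) - b) =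
      (a - b) * ((phi x : ℂ) * (((x : ℂ) - a)⁻¹ * ((x : ℂ) - b)⁻¹)) := by
    field_simp; ring
  rw [this, norm_mul, norm_mul, norm_mul, Complex.norm_real, Real.norm_of_nonneg (phi_nonneg x)]

lemma norm_s_le_inv {z : ℂ} (hz : 0 < z.im) : ‖s z‖ ≤ z.im⁻¹ := by
  have : ‖s z‖ ≤ ∫ x, phi x * z.im⁻¹ := by
    refine norm_integral_le_of_norm_le (integrable_phi.mul_const _)
      (Eventually.of_forall fun x => ?_)
    rw [div_eq_mul_inv, norm_mul, Complex.norm_real, Real.norm_of_nonneg (phi_nonneg x)]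
    exact mul_le_mul_of_nonneg_left (norm_inv_le hz x) (phi_nonneg x)
  rwa [integral_mul_const, integral_phi, one_mul] at this

lemma s_im_nonneg {z : ℂ} (hz : 0 < z.im) : 0 ≤ (s z).im := by
  rw [im_s hz]; exact mul_nonneg hz.le (J_nonneg _ _)

lemma fixed_unique {z a b : ℂ} (hz : 0 < z.im) (ha : 0 < a.im) (hb : 0 < b.im)
    (ea : a = z + s a) (eb : b = z + s b) : a = b := by
  have lt : ∀ {c : ℂ}, 0 < c.im → c = z + s c → J c c < 1 := by
    intro c hc ec
    have := congrArg Complex.im ec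
    rw [Complex.add_im, im_s hc] at this
    by_contra h
    nlinarith [not_lt.mp h]
  have hJ : J a b < 1 := by
    have h1 := lt ha ea
    have h2 := lt hb eb
    have h3 := J_sq_le ha hb
    have := J_nonneg a a
    have := J_nonneg b b
    nlinarith [J_nonneg a b]
  have h := norm_s_sub_le ha hb
  have e : s a - s b = a - b := by linear_combination eb - ea
  rw [e] at h
  by_contra hne
  have : 0 < ‖a - b‖ := norm_pos_iff.mpr (sub_ne_zero.mpr hne)
  nlinarith

lemma fixed_exists {z : ℂ} (hz : 0 < z.im) : ∃ a : ℂ, z.im ≤ a.im ∧ a = z + s a := by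
  let f : ℂ → ℂ := fun a => z + s a
  let w : ℕ → ℂ := fun n => f^[n] z
  have w_succ : ∀ n, w (n + 1) = z + s (w n) := fun n => Function.iterate_succ_apply' f n z
  have w_im : ∀ n, z.im ≤ (w n).im := by
    intro n
    induction n with
    | zero => exact le_refl _
    | succ n ih =>
      rw [w_succ, Complex.add_im]
      linarith [s_im_nonneg (hz.trans_le ih)]
  have w_pos : ∀ n, 0 < (w n).im := fun n => hz.trans_le (w_im n)
  set y := z.im with hy
  have w_ub : ∀ n, (w n).im ≤ y + y⁻¹ := by
    intro n
    cases n with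
    | zero => exact le_add_of_nonneg_right (by positivity)
    | succ n =>
      rw [w_succ, Complex.add_im]
      have h1 := Complex.im_le_norm (s (w n))
      have h2 := norm_s_le_inv (w_pos n)
      have h3 := inv_anti₀ hz (w_im n)
      linarith
  set k : ℝ := y⁻¹ / (y + y⁻¹) with hk
  have hyi : 0 < y⁻¹ := inv_pos.mpr hz
  have k_nonneg : 0 ≤ k := by positivity
  have k_lt : k < 1 := by rw [hk, div_lt_one (by positivity)]; linarith
  have hkmul : k * (y + y⁻¹) = y⁻¹ := by rw [hk]; field_simp
  have Jw : ∀ n, (w n).im * J (w n) (w n) ≤ k * (w (n + 1)).im := by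
    intro n
    have h1 : (w (n + 1)).im = y + (w n).im * J (w n) (w n) := by
      rw [w_succ, Complex.add_im, im_s (w_pos n)]
    have h2 := w_ub (n + 1)
    have h3 : y = (1 - k) * (y + y⁻¹) := by linarith
    have : (1 - k) * (w (n + 1)).im ≤ (1 - k) * (y + y⁻¹) :=
      mul_le_mul_of_nonneg_left h2 (by linarith)
    linarith
  obtain ⟨D, hD0, hD⟩ : ∃ D : ℝ, 0 ≤ D ∧ ‖w 1 - w 0‖ ^ 2 ≤ D * ((w 0).im * (w 1).im) := by
    have hp : 0 < (w 0).im * (w 1).im := mul_pos (w_pos 0) (w_pos 1)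
    exact ⟨‖w 1 - w 0‖ ^ 2 / ((w 0).im * (w 1).im), by positivity, by
      rw [div_mul_cancel₀ _ hp.ne']⟩
  have step : ∀ n, ‖w (n + 1) - w n‖ ^ 2 ≤ D * (k ^ n) ^ 2 * ((w n).im * (w (n + 1)).im) := by
    intro n
    induction n with
    | zero => simpa using hD
    | succ n ih =>
      have e : w (n + 1 + 1) - w (n + 1) = s (w (n + 1)) - s (w n) := by
        rw [w_succ (n + 1), w_succ n]; ring
      have h1 := norm_s_sub_le (w_pos (n + 1)) (w_pos n)
      rw [← e] at h1
      have h2 : ‖w (n + 1 + 1) - w (n + 1)‖ ^ 2 ≤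
          ‖w (n + 1) - w n‖ ^ 2 * (J (w (n + 1)) (w (n + 1)) * J (w n) (w n)) := by
        calc _ ≤ (‖w (n + 1) - w n‖ * J (w (n + 1)) (w n)) ^ 2 :=
              pow_le_pow_left₀ (norm_nonneg _) h1 2
          _ = ‖w (n + 1) - w n‖ ^ 2 * J (w (n + 1)) (w n) ^ 2 := by ring
          _ ≤ _ := mul_le_mul_of_nonneg_left (J_sq_le (w_pos _) (w_pos _)) (sq_nonneg _)
      have hJJ : 0 ≤ J (w (n + 1)) (w (n + 1)) * J (w n) (w n) :=
        mul_nonneg (J_nonneg _ _) (J_nonneg _ _)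
      calc _ ≤ _ := h2
        _ ≤ D * (k ^ n) ^ 2 * ((w n).im * (w (n + 1)).im) *
            (J (w (n + 1)) (w (n + 1)) * J (w n) (w n)) := mul_le_mul_of_nonneg_right ih hJJ
        _ = D * (k ^ n) ^ 2 * (((w (n + 1)).im * J (w (n + 1)) (w (n + 1))) *
            ((w n).im * J (w n) (w n))) := by ring
        _ ≤ D * (k ^ n) ^ 2 * ((k * (w (n + 1 + 1)).im) * (k * (w (n + 1)).im)) := by
            refine mul_le_mul_of_nonneg_left ?_ (by positivity)
            exact mul_le_mul (Jw (n + 1)) (Jw n)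
              (mul_nonneg (w_pos n).le (J_nonneg _ _))
              (mul_nonneg k_nonneg (w_pos _).le)
        _ = _ := by ring
  have geo : ∀ n, dist (w n) (w (n + 1)) ≤ Real.sqrt D * (y + y⁻¹) * k ^ n := by
    intro n
    rw [dist_comm, dist_eq_norm]
    refine abs_le_of_sq_le_sq' (a := ‖w (n + 1) - w n‖) ?_ (by positivity) |>.2
    calc _ ≤ _ := step n
      _ ≤ D * (k ^ n) ^ 2 * ((y + y⁻¹) * (y + y⁻¹)) := by
          refine mul_le_mul_of_nonneg_left ?_ (by positivity)
          exact mul_le_mul (w_ub n) (w_ub (n + 1)) (w_pos _).le (by positivity)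
      _ = _ := by
          rw [mul_pow, mul_pow, Real.sq_sqrt hD0]; ring
  obtain ⟨a, ha⟩ := cauchySeq_tendsto_of_complete (cauchySeq_of_le_geometric k _ k_lt geo)
  have hay : y ≤ a.im :=
    ge_of_tendsto ((Complex.continuous_im.tendsto a).comp ha) (Eventually.of_forall w_im)
  have hapos : 0 < a.im := hz.trans_le hay
  refine ⟨a, hay, ?_⟩
  have hs : Tendsto (fun n => s (w n)) atTop (𝓝 (s a)) := by
    rw [tendsto_iff_norm_sub_tendsto_zero]
    have h0 : Tendsto (fun n => ‖w n - a‖ * (y⁻¹ * y⁻¹)) atTop (𝓝 0) := by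
      simpa using (tendsto_iff_norm_sub_tendsto_zero.mp ha).mul_const (y⁻¹ * y⁻¹)
    refine squeeze_zero (fun _ => norm_nonneg _) (fun n => ?_) h0
    refine (norm_s_sub_le (w_pos n) hapos).trans (mul_le_mul_of_nonneg_left ?_ (norm_nonneg _))
    refine (J_le (w_pos n) hapos).trans ?_
    exact mul_le_mul (inv_anti₀ hz (w_im n)) (inv_anti₀ hz hay) (by positivity) (by positivity)
  have h1 : Tendsto (fun n => w (n + 1)) atTop (𝓝 (z + s a)) := by
    simp_rw [w_succ]
    exact tendsto_const_nhds.add hs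
  exact tendsto_nhds_unique ((tendsto_add_atTop_iff_nat 1).mpr ha) h1

lemma integral_phi_cexp (t : ℝ) :
    ∫ x : ℝ, (phi x : ℂ) * Complex.exp (-(Complex.I * t * x)) =
      Complex.exp (-(t : ℂ) ^ 2 / 2) := by
  have h := fourierIntegral_gaussian (b := (1 / 2 : ℂ)) (by norm_num) (-t)
  have e : ∀ x : ℝ, (phi x : ℂ) * Complex.exp (-(Complex.I * t * x)) =
      ((1 / Real.sqrt (2 * Real.pi) : ℝ) : ℂ) *
        (Complex.exp (Complex.I * (-t) * x) * Complex.exp (-(1 / 2) * (x : ℂ) ^ 2)) := by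
    intro x
    rw [phi_eq, Complex.ofReal_mul, Complex.ofReal_exp]
    push_cast
    rw [show -(Complex.I * t * x) = Complex.I * (-t) * x by ring]
    ring
  simp_rw [e]
  rw [integral_const_mul, h]
  have h2 : ((Real.pi : ℂ) / (1 / 2)) ^ (1 / 2 : ℂ) = ((Real.sqrt (2 * Real.pi) : ℝ) : ℂ) := by
    rw [Real.sqrt_eq_rpow, Complex.ofReal_cpow (by positivity)]
    push_cast
    congr 1
    ring
  rw [h2, ← mul_assoc, ← Complex.ofReal_mul]
  have h3 : Real.sqrt (2 * Real.pi) ≠ 0 := by positivity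
  rw [one_div, inv_mul_cancel₀ h3, Complex.ofReal_one, one_mul]
  congr 1
  ring

/-- The integrand of the half-line representation of `s`. -/
noncomputable def g (z : ℂ) (t : ℝ) : ℂ := Complex.exp (Complex.I * t * z - (t : ℂ) ^ 2 / 2)

lemma s_eq_integral {z : ℂ} (hz : 0 < z.im) : s z = Complex.I * ∫ t in Set.Ioi (0 : ℝ), g z t := by
  have hre : (Complex.I * z).re < 0 := by simpa using hz
  have hint : IntegrableOn (fun t : ℝ => Complex.exp (Complex.I * z * t)) (Set.Ioi 0) :=
    integrableOn_exp_mul_complex_Ioi hre 0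
  have inner : ∀ x : ℝ, ∫ t in Set.Ioi (0 : ℝ), (phi x : ℂ) * Complex.exp (Complex.I * (z - x) * t)
      = -Complex.I * ((phi x : ℂ) / ((x : ℂ) - z)) := by
    intro x
    rw [integral_const_mul, integral_exp_mul_complex_Ioi (by simpa using hz)]
    have h1 := sub_ne hz x
    have h2 : z - (x : ℂ) ≠ 0 := by rw [← neg_sub]; exact neg_ne_zero.mpr h1
    have hI := Complex.I_ne_zero
    simp only [Complex.ofReal_zero, mul_zero, Complex.exp_zero]
    rw [← neg_sub (x : ℂ) z]
    field_simp
    simp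
  have swap : ∫ x : ℝ, ∫ t in Set.Ioi (0 : ℝ), (phi x : ℂ) * Complex.exp (Complex.I * (z - x) * t)
      = ∫ t in Set.Ioi (0 : ℝ), ∫ x : ℝ, (phi x : ℂ) * Complex.exp (Complex.I * (z - x) * t) := by
    refine integral_integral_swap ?_
    have h := integrable_phi.ofReal (𝕜 := ℂ) |>.mul_prod hint
    have h' := h.mul_bdd (c := 1)
      (g := fun p : ℝ × ℝ => Complex.exp (-(Complex.I * p.2 * p.1)))
      (by fun_prop) (Eventually.of_forall fun p => by
        rw [Complex.norm_exp]; simp)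
    refine h'.congr (Eventually.of_forall fun p => ?_)
    simp only [Function.uncurry]
    rw [mul_assoc, ← Complex.exp_add]
    congr 2
    ring
  have inner2 : ∀ t : ℝ, ∫ x : ℝ, (phi x : ℂ) * Complex.exp (Complex.I * (z - x) * t) = g z t := by
    intro t
    have e : ∀ x : ℝ, (phi x : ℂ) * Complex.exp (Complex.I * (z - x) * t) =
        Complex.exp (Complex.I * t * z) * ((phi x : ℂ) * Complex.exp (-(Complex.I * t * x))) := by
      intro x
      rw [mul_left_comm, ← Complex.exp_add]
      congr 2
      ring
    simp_rw [e]
    rw [integral_const_mul, integral_phi_cexp, ← Complex.exp_add]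
    unfold g
    congr 1
    ring
  simp_rw [inner, inner2] at swap
  rw [integral_const_mul] at swap
  rw [← swap, ← mul_assoc]
  simp [s]

lemma norm_g_le {z : ℂ} (hz : 0 < z.im) {t : ℝ} (ht : 0 ≤ t) :
    ‖g z t‖ ≤ Real.exp (-(1 / 2) * t ^ 2) := by
  unfold g
  rw [Complex.norm_exp]
  apply Real.exp_le_exp.mpr
  have h2 : ((t : ℂ) ^ 2 / 2).re = t ^ 2 / 2 := by
    rw [show (t : ℂ) ^ 2 / 2 = ((t ^ 2 / 2 : ℝ) : ℂ) by push_cast; ring, Complex.ofReal_re]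
  have h1 : (Complex.I * t * z).re = -(t * z.im) := by simp
  rw [Complex.sub_re, h1, h2]
  nlinarith [mul_nonneg ht hz.le]

lemma continuous_g (z : ℂ) : Continuous (g z) := by unfold g; fun_prop

lemma integrable_bound (n : ℕ) :
    Integrable fun t : ℝ => t ^ n * Real.exp (-(1 / 2) * t ^ 2) := by
  have := integrable_rpow_mul_exp_neg_mul_sq (b := 1 / 2) (by norm_num) (s := n)
    (by have : (0 : ℝ) ≤ n := n.cast_nonneg
        linarith)
  simpa using this

lemma norm_pow_g_le {z : ℂ} (hz : 0 < z.im) (n : ℕ) {t : ℝ} (ht : 0 ≤ t) :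
    ‖(t : ℂ) ^ n * g z t‖ ≤ t ^ n * Real.exp (-(1 / 2) * t ^ 2) := by
  rw [norm_mul, norm_pow, Complex.norm_real, Real.norm_of_nonneg ht]
  exact mul_le_mul_of_nonneg_left (norm_g_le hz ht) (by positivity)

lemma integrable_pow_g {z : ℂ} (hz : 0 < z.im) (n : ℕ) :
    IntegrableOn (fun t : ℝ => (t : ℂ) ^ n * g z t) (Set.Ioi 0) := by
  refine Integrable.mono' (integrable_bound n).integrableOn
    (by have := continuous_g z
        exact Continuous.aestronglyMeasurable (by fun_prop)) ?_
  refine (ae_restrict_iff' measurableSet_Ioi).mpr (Eventually.of_forall fun t ht => ?_)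
  exact norm_pow_g_le hz n (le_of_lt ht)

/-- The moments of `g z` on the half-line. -/
noncomputable def F (n : ℕ) (z : ℂ) : ℂ := ∫ t in Set.Ioi (0 : ℝ), (t : ℂ) ^ n * g z t

lemma norm_F_le {z : ℂ} (hz : 0 < z.im) (n : ℕ) :
    ‖F n z‖ ≤ ∫ t in Set.Ioi (0 : ℝ), t ^ n * Real.exp (-(1 / 2) * t ^ 2) := by
  refine norm_integral_le_of_norm_le (integrable_bound n).integrableOn ?_
  refine (ae_restrict_iff' measurableSet_Ioi).mpr (Eventually.of_forall fun t ht => ?_)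
  exact norm_pow_g_le hz n (le_of_lt ht)

lemma hasDerivAt_g (z : ℂ) (t : ℝ) : HasDerivAt (g z) ((Complex.I * z - t) * g z t) t := by
  unfold g
  have h1 : HasDerivAt (fun t : ℝ => (t : ℂ)) 1 t := Complex.ofRealCLM.hasDerivAt
  have h2 : HasDerivAt (fun t : ℝ => Complex.I * t * z - (t : ℂ) ^ 2 / 2)
      (Complex.I * 1 * z - ((2 : ℕ) * (t : ℂ) ^ (2 - 1) * 1) / 2) t :=
    ((h1.const_mul Complex.I).mul_const z).sub ((h1.pow 2).div_const 2)
  convert! h2.cexp using 1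
  push_cast
  ring

lemma tendsto_pow_g {z : ℂ} (hz : 0 < z.im) (n : ℕ) :
    Tendsto (fun t : ℝ => (t : ℂ) ^ n * g z t) atTop (𝓝 0) := by
  have h : Tendsto (fun t : ℝ => t ^ n * Real.exp (-(1 / 2) * t ^ 2)) atTop (𝓝 0) := by
    have h1 := rpow_mul_exp_neg_mul_sq_isLittleO_exp_neg (b := 1 / 2) (by norm_num) n
    have h2 : Tendsto (fun x : ℝ => Real.exp (-(1 / 2) * x)) atTop (𝓝 0) :=
      Real.tendsto_exp_atBot.comp (tendsto_id.const_mul_atTop_of_neg (by norm_num))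
    simpa using h1.trans_tendsto h2
  refine squeeze_zero_norm' ?_ h
  filter_upwards [eventually_ge_atTop 0] with t ht
  exact norm_pow_g_le hz n ht

lemma F_rec_zero {z : ℂ} (hz : 0 < z.im) : Complex.I * z * F 0 z - F 1 z = -1 := by
  have hi : IntegrableOn (fun t : ℝ => Complex.I * z * ((t : ℂ) ^ 0 * g z t) - (t : ℂ) ^ 1 * g z t)
      (Set.Ioi 0) := ((integrable_pow_g hz 0).const_mul _).sub (integrable_pow_g hz 1)
  have h := integral_Ioi_of_hasDerivAt_of_tendsto' (a := (0 : ℝ)) (f := g z)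
    (f' := fun t => Complex.I * z * ((t : ℂ) ^ 0 * g z t) - (t : ℂ) ^ 1 * g z t) (m := 0)
    (fun t _ => by convert! hasDerivAt_g z t using 1; ring)
    hi
    (by simpa using tendsto_pow_g hz 0)
  rw [integral_sub ((integrable_pow_g hz 0).const_mul _) (integrable_pow_g hz 1),
    integral_const_mul] at h
  unfold F
  rw [h]
  simp [g]

lemma F_rec_one {z : ℂ} (hz : 0 < z.im) : F 0 z + Complex.I * z * F 1 z - F 2 z = 0 := by
  have hi0 : IntegrableOn
      (fun t : ℝ => (t : ℂ) ^ 0 * g z t + Complex.I * z * ((t : ℂ) ^ 1 * g z t)) (Set.Ioi 0) :=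
    (integrable_pow_g hz 0).add ((integrable_pow_g hz 1).const_mul _)
  have hi : IntegrableOn (fun t : ℝ => ((t : ℂ) ^ 0 * g z t + Complex.I * z * ((t : ℂ) ^ 1 * g z t))
      - (t : ℂ) ^ 2 * g z t) (Set.Ioi 0) := hi0.sub (integrable_pow_g hz 2)
  have h := integral_Ioi_of_hasDerivAt_of_tendsto' (a := (0 : ℝ))
    (f := fun t => (t : ℂ) ^ 1 * g z t)
    (f' := fun t => ((t : ℂ) ^ 0 * g z t + Complex.I * z * ((t : ℂ) ^ 1 * g z t))
      - (t : ℂ) ^ 2 * g z t) (m := 0)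
    (fun t _ => by
      have h1 : HasDerivAt (fun t : ℝ => (t : ℂ)) 1 t := Complex.ofRealCLM.hasDerivAt
      have h2 := h1.mul (hasDerivAt_g z t)
      simp only [pow_one]
      convert! h2 using 1; ring)
    hi
    (tendsto_pow_g hz 1)
  rw [integral_sub hi0 (integrable_pow_g hz 2),
    integral_add (integrable_pow_g hz 0) ((integrable_pow_g hz 1).const_mul _),
    integral_const_mul] at h
  unfold F
  rw [h]
  simp

lemma s_asymptotics : ∃ K : ℝ, 0 ≤ K ∧ ∀ z : ℂ, 0 < z.im →
    ‖s z‖ ≤ K ∧ ‖z * s z + 1‖ ≤ K / ‖z‖ := by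
  set B : ℕ → ℝ := fun n => ∫ t in Set.Ioi (0 : ℝ), t ^ n * Real.exp (-(1 / 2) * t ^ 2) with hB
  have hB0 : ∀ n, 0 ≤ B n := fun n => setIntegral_nonneg measurableSet_Ioi fun t ht => by
    have : (0 : ℝ) < t := ht
    positivity
  refine ⟨B 0 + B 2, add_nonneg (hB0 0) (hB0 2), fun z hz => ?_⟩
  have hs : s z = Complex.I * F 0 z := by
    rw [s_eq_integral hz]; simp [F]
  have n0 : ‖F 0 z‖ ≤ B 0 := norm_F_le hz 0
  have n2 : ‖F 2 z‖ ≤ B 2 := norm_F_le hz 2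
  have hz0 : z ≠ 0 := by rintro rfl; simp at hz
  constructor
  · rw [hs, norm_mul, Complex.norm_I, one_mul]
    linarith [hB0 2]
  · have e1 : z * s z + 1 = F 1 z := by
      rw [hs]; linear_combination F_rec_zero hz
    rw [e1, le_div_iff₀ (norm_pos_iff.mpr hz0)]
    have e2 : Complex.I * z * F 1 z = F 2 z - F 0 z := by linear_combination F_rec_one hz
    have e3 := congrArg norm e2
    rw [norm_mul, norm_mul, Complex.norm_I, one_mul] at e3
    rw [mul_comm, e3]
    linarith [norm_sub_le (F 2 z) (F 0 z)]

lemma integral_eq_s (z w : ℂ) : ∫ x : ℝ, (phi x : ℂ) / ((x : ℂ) - z - w) = s (z + w) := by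
  unfold s; simp_rw [sub_sub]

/-- There is exactly one function on the upper half-plane with these properties. -/
theorem existsUnique_transform : ∃! m : UpperHalfPlane → ℂ, IsFreeConvTransform m := by
  have hex : ∀ z : UpperHalfPlane, ∃ a : ℂ, (z : ℂ).im ≤ a.im ∧ a = z + s a :=
    fun z => fixed_exists z.im_pos
  choose a ha1 ha2 using hex
  have hap : ∀ z, 0 < (a z).im := fun z => lt_of_lt_of_le z.im_pos (ha1 z)
  have hm : ∀ z, a z - z = s (a z) := fun z => sub_eq_of_eq_add' (ha2 z)
  refine ⟨fun z => a z - z, ⟨fun z => ?_, fun z => ?_, ?_⟩, fun m' h => ?_⟩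
  · rw [Complex.sub_im]; linarith [ha1 z]
  · rw [integral_eq_s, add_sub_cancel, hm]
  · obtain ⟨K, hK0, hK⟩ := s_asymptotics
    rw [tendsto_iff_norm_sub_tendsto_zero]
    set l : Filter UpperHalfPlane := comap (fun z : UpperHalfPlane => ‖(z : ℂ)‖) atTop
    have hl : Tendsto (fun z : UpperHalfPlane => ‖(z : ℂ)‖) l atTop := tendsto_comap
    have hal : Tendsto (fun z : UpperHalfPlane => ‖a z‖) l atTop := by
      refine tendsto_atTop_mono (fun z => ?_) (tendsto_atTop_add_const_right l (-K) hl)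
      have h1 := (hK _ (hap z)).1
      rw [← hm] at h1
      have h2 := norm_sub_norm_le (z : ℂ) (a z)
      rw [norm_sub_rev] at h2
      linarith
    have hlim : Tendsto (fun z : UpperHalfPlane => (K + K * (1 + K)) / ‖a z‖ + K ^ 2 / ‖a z‖)
        l (𝓝 0) := by
      simpa using (hal.const_div_atTop (K + K * (1 + K))).add (hal.const_div_atTop (K ^ 2))
    refine squeeze_zero' (Eventually.of_forall fun _ => norm_nonneg _) ?_ hlim
    filter_upwards [hal.eventually_ge_atTop 1] with z hz1
    have h1 := hK _ (hap z)
    have hpos : 0 < ‖a z‖ := by linarith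
    have e : (z : ℂ) * (a z - z) - -1 = (a z * s (a z) + 1) - s (a z) * s (a z) := by
      rw [hm]; nth_rewrite 1 [← sub_sub_cancel (a z) (z : ℂ)]; rw [hm]; ring
    have hs2 : ‖s (a z)‖ ≤ (1 + K) / ‖a z‖ := by
      rw [le_div_iff₀ hpos, mul_comm, ← norm_mul]
      have h3 : ‖a z * s (a z)‖ ≤ ‖a z * s (a z) + 1‖ + 1 := by
        have := norm_sub_le (a z * s (a z) + 1) 1
        simpa using this
      have h4 : K / ‖a z‖ ≤ K := div_le_self hK0 hz1
      linarith [h1.2]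
    rw [e]
    refine (norm_sub_le _ _).trans ?_
    rw [norm_mul]
    have h5 : ‖s (a z)‖ * ‖s (a z)‖ ≤ K * ((1 + K) / ‖a z‖) :=
      mul_le_mul h1.1 hs2 (norm_nonneg _) hK0
    have h6 : 0 ≤ K ^ 2 / ‖a z‖ := by positivity
    rw [add_div, mul_div_assoc]
    linarith [h1.2]
  · funext z
    have h1 : 0 < ((z : ℂ) + m' z).im := by
      rw [Complex.add_im]
      have := z.im_pos
      have h2 := h.im_nonneg z
      rw [UpperHalfPlane.coe_im]
      linarith
    have h2 : (z : ℂ) + m' z = z + s (z + m' z) := by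
      congr 1
      rw [← integral_eq_s]
      exact h.fixed_point z
    have := fixed_unique (z := (z : ℂ)) z.im_pos h1 (hap z) h2 (ha2 z)
    rw [← this]
    ring

/-- The Stieltjes transform of the free convolution of the semicircle law with the standard normal
law. -/
noncomputable def m : UpperHalfPlane → ℂ := Classical.choose existsUnique_transform.exists

lemma m_spec : IsFreeConvTransform m := Classical.choose_spec existsUnique_transform.exists

/-- The spectral line: `sqrt ((2 - δ) log n) ≤ Re z ≤ sqrt (3 log n)` and `Im z = n ^ (-1/4)`. -/
def STilde (δ : ℝ) (n : ℕ) : Set UpperHalfPlane :=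
  {z | Real.sqrt ((2 - δ) * Real.log n) ≤ z.re ∧ z.re ≤ Real.sqrt (3 * Real.log n) ∧
    z.im = (n : ℝ) ^ (-(1 / 4) : ℝ)}

end GaussFC

/-! Both `m z` and the perturbed solution `mt` solve `c = s (z + c)`, the latter up to the error
`e`, so stability follows once `s` is a contraction near `z`. This holds far from the origin,
uniformly up to the real axis.

The half-line representation `s z = I * F 0 z` replaces the singular kernel `1 / (x - z)` by `exp (I
t z)`, which is bounded by 1 and `t`-Lipschitz in `z` on the upper half-plane. Against the Gaussian
weight, every moment `F n` is therefore Lipschitz there (`norm_F_sub_le`). The identity `z * s z + 1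
= F 1 z` divides this by `|z|`: `s` has Lipschitz constant `L / R` on `|z| ≥ R`
(`exists_lipschitz_s`).

Since `s` is bounded, both solutions are bounded, and a large `Re z` keeps `z + m z` and `z + mt` in
the region where the constant is at most `1/2`. Then `|m z - mt| ≤ |m z - mt| / 2 + |e|`
(`exists_stability`). A large `n` makes `Re z ≥ √((2 - δ) log n)` large enough. -/

namespace GaussFC

/-! ### Lipschitz bounds uniform up to the real axis -/

lemma norm_cexp_sub_cexp_le {u v : ℂ} (hu : u.re ≤ 0) (hv : v.re ≤ 0) :
    ‖Complex.exp u - Complex.exp v‖ ≤ ‖u - v‖ := by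
  -- Mean value inequality on the convex left half-plane, where `|exp' w| = exp (Re w) ≤ 1`.
  have h := Convex.norm_image_sub_le_of_norm_hasDerivWithin_le (𝕜 := ℂ)
    (f := Complex.exp) (f' := Complex.exp) (s := {w : ℂ | w.re ≤ 0}) (C := 1)
    (fun w _ => (Complex.hasDerivAt_exp w).hasDerivWithinAt)
    (fun w hw => by
      rw [Complex.norm_exp]
      exact Real.exp_le_one_iff.mpr hw)
    (convex_halfSpace_re_le 0) (x := v) (y := u) hv hu
  rwa [one_mul] at h

/-- Once the Gaussian weight is factored out, what remains is `exp (I t z)`, whose exponent lies in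
the left half-plane and is `t`-Lipschitz in `z`. The bound does not degenerate as the imaginary
parts tend to 0. -/
lemma norm_g_sub_le {a b : ℂ} (ha : 0 < a.im) (hb : 0 < b.im) {t : ℝ} (ht : 0 ≤ t) :
    ‖g a t - g b t‖ ≤ t * Real.exp (-(1 / 2) * t ^ 2) * ‖a - b‖ := by
  have split : ∀ z : ℂ, g z t =
      ((Real.exp (-(1 / 2) * t ^ 2) : ℝ) : ℂ) * Complex.exp (Complex.I * t * z) := by
    intro z
    rw [Complex.ofReal_exp, ← Complex.exp_add, g]
    congr 1
    push_cast
    ring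
  have hre : ∀ {z : ℂ}, 0 < z.im → (Complex.I * t * z).re ≤ 0 := by
    intro z hz
    simpa using mul_nonneg ht hz.le
  have h := norm_cexp_sub_cexp_le (hre ha) (hre hb)
  rw [← mul_sub, norm_mul, norm_mul, Complex.norm_I, one_mul, Complex.norm_real,
    Real.norm_of_nonneg ht] at h
  rw [split, split, ← mul_sub, norm_mul, Complex.norm_real, Real.norm_of_nonneg (Real.exp_nonneg _)]
  calc _ ≤ Real.exp (-(1 / 2) * t ^ 2) * (t * ‖a - b‖) :=
        mul_le_mul_of_nonneg_left h (Real.exp_nonneg _)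
    _ = _ := by ring

/-- The moments `F n` are Lipschitz on the upper half-plane. -/
lemma norm_F_sub_le {a b : ℂ} (ha : 0 < a.im) (hb : 0 < b.im) (n : ℕ) :
    ‖F n a - F n b‖ ≤
      (∫ t in Set.Ioi (0 : ℝ), t ^ (n + 1) * Real.exp (-(1 / 2) * t ^ 2)) * ‖a - b‖ := by
  unfold F
  rw [← integral_sub (integrable_pow_g ha n) (integrable_pow_g hb n), ← integral_mul_const]
  -- The Lipschitz factor `t` of the integrand raises the dominating moment from `n` to `n + 1`.
  refine norm_integral_le_of_norm_le ((integrable_bound (n + 1)).integrableOn.mul_const _) ?_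
  refine (ae_restrict_iff' measurableSet_Ioi).mpr (Eventually.of_forall fun t ht => ?_)
  have ht0 : 0 ≤ t := le_of_lt ht
  rw [← mul_sub, norm_mul, norm_pow, Complex.norm_real, Real.norm_of_nonneg ht0]
  calc _ ≤ t ^ n * (t * Real.exp (-(1 / 2) * t ^ 2) * ‖a - b‖) :=
        mul_le_mul_of_nonneg_left (norm_g_sub_le ha hb ht0) (by positivity)
    _ = _ := by ring

/-- Integration by parts in the half-line representation, in the form of `F_rec_zero`. It trades a
factor `z` for a function with a uniform Lipschitz bound. -/
lemma mul_s_add_one {z : ℂ} (hz : 0 < z.im) : z * s z + 1 = F 1 z := by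
  have hs : s z = Complex.I * F 0 z := by
    rw [s_eq_integral hz]; simp [F]
  rw [hs]
  linear_combination F_rec_zero hz

/-- Far from the origin, `s` has a small Lipschitz constant, uniformly up to the real axis. -/
lemma exists_lipschitz_s : ∃ L : ℝ, 0 < L ∧ ∀ a b : ℂ, 0 < a.im → 0 < b.im → ∀ R : ℝ, 1 ≤ R →
    R ≤ ‖a‖ → R ≤ ‖b‖ → ‖s a - s b‖ ≤ L / R * ‖a - b‖ := by
  set B : ℕ → ℝ := fun n => ∫ t in Set.Ioi (0 : ℝ), t ^ n * Real.exp (-(1 / 2) * t ^ 2) with hB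
  have hB0 : ∀ n, 0 ≤ B n := fun n => setIntegral_nonneg measurableSet_Ioi fun t ht => by
    have : (0 : ℝ) < t := ht
    positivity
  -- `B 2` is the Lipschitz constant of `F 1`, and `B 1 + 1` bounds `‖s b‖` when `‖b‖ ≥ 1`.
  refine ⟨B 2 + B 1 + 1, by linarith [hB0 1, hB0 2], fun a b ha hb R hR hRa hRb => ?_⟩
  have hRpos : 0 < R := by linarith
  have lip : ‖F 1 a - F 1 b‖ ≤ B 2 * ‖a - b‖ := norm_F_sub_le ha hb 1
  have hs : ‖s b‖ ≤ B 1 + 1 := by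
    have h1 : ‖b‖ * ‖s b‖ ≤ B 1 + 1 := by
      rw [← norm_mul, eq_sub_of_add_eq (mul_s_add_one hb)]
      refine (norm_sub_le _ _).trans ?_
      rw [norm_one]
      linarith [show ‖F 1 b‖ ≤ B 1 from norm_F_le hb 1]
    nlinarith [norm_nonneg (s b)]
  -- Difference of `z * s z + 1 = F 1 z` at `a` and `b`. The factor `a` on the left supplies the
  -- gain `1 / R`.
  have e : a * (s a - s b) = (F 1 a - F 1 b) - (a - b) * s b := by
    linear_combination mul_s_add_one ha - mul_s_add_one hb
  have h := norm_sub_le (F 1 a - F 1 b) ((a - b) * s b)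
  rw [← e, norm_mul, norm_mul] at h
  rw [div_mul_eq_mul_div, le_div_iff₀ hRpos]
  have h1 : ‖a - b‖ * ‖s b‖ ≤ ‖a - b‖ * (B 1 + 1) :=
    mul_le_mul_of_nonneg_left hs (norm_nonneg _)
  have h2 : R * ‖s a - s b‖ ≤ ‖a‖ * ‖s a - s b‖ :=
    mul_le_mul_of_nonneg_right hRa (norm_nonneg _)
  linarith

/-! ### Contraction and stability -/

lemma m_eq_s (z : UpperHalfPlane) : m z = s ((z : ℂ) + m z) := by
  rw [← integral_eq_s]
  exact m_spec.fixed_point z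

/-- Stability of the fixed point equation at spectral parameters with large real part. -/
lemma exists_stability : ∃ A : ℝ, 0 < A ∧ ∀ (z : UpperHalfPlane) (e mt : ℂ), A ≤ z.re → ‖e‖ ≤ 1 →
    0 ≤ mt.im → mt = s ((z : ℂ) + mt) + e → ‖m z - mt‖ ≤ 2 * ‖e‖ := by
  obtain ⟨K, hK0, hK⟩ := s_asymptotics
  obtain ⟨L, hL0, hL⟩ := exists_lipschitz_s
  -- `K + 1` bounds both solutions, so shifting `z` by either leaves modulus at least `2 * L + 1`,
  -- where the Lipschitz constant `L / (2 * L + 1)` is below `1/2`.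
  refine ⟨2 * L + 1 + (K + 1), by positivity, fun z e mt hz he hmt heq => ?_⟩
  have im_pos : ∀ {c : ℂ}, 0 ≤ c.im → 0 < ((z : ℂ) + c).im := by
    intro c hc
    rw [Complex.add_im, UpperHalfPlane.coe_im]
    linarith [z.im_pos]
  have far : ∀ {c : ℂ}, ‖c‖ ≤ K + 1 → 2 * L + 1 ≤ ‖(z : ℂ) + c‖ := by
    intro c hc
    have h1 := Complex.re_le_norm ((z : ℂ) + c)
    rw [Complex.add_re, UpperHalfPlane.coe_re] at h1
    have h2 := neg_le_of_abs_le (Complex.abs_re_le_norm c)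
    linarith
  have pm := im_pos (m_spec.im_nonneg z)
  have pt := im_pos hmt
  have bm : ‖m z‖ ≤ K + 1 := by
    rw [m_eq_s]
    linarith [(hK _ pm).1]
  have bt : ‖mt‖ ≤ K + 1 := by
    rw [heq]
    exact (norm_add_le _ _).trans (add_le_add (hK _ pt).1 he)
  have lip := hL _ _ pm pt (2 * L + 1) (by linarith) (far bm) (far bt)
  rw [add_sub_add_left_eq_sub] at lip
  have half : L / (2 * L + 1) ≤ 1 / 2 := by
    rw [div_le_div_iff₀ (by positivity) (by norm_num)]
    linarith
  have split : m z - mt = (s ((z : ℂ) + m z) - s ((z : ℂ) + mt)) - e := by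
    linear_combination m_eq_s z - heq
  have tri := norm_sub_le (s ((z : ℂ) + m z) - s ((z : ℂ) + mt)) e
  rw [← split] at tri
  -- Half of `‖m z - mt‖` is absorbed into the left-hand side, which produces the factor 2.
  have := mul_le_mul_of_nonneg_right half (norm_nonneg (m z - mt))
  linarith

end GaussFC

theorem theorem4p1 (δ : ℝ) (hδ : δ ∈ Set.Ioo (0 : ℝ) 1) :
    ∃ C : ℝ, 0 < C ∧
      ∀ ε : ℕ → ℂ, (∀ n, ‖ε n‖ ≤ 1) → Tendsto ε atTop (𝓝 0) →
        ∀ n : ℕ, C < (n : ℝ) →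
          ∀ z ∈ GaussFC.STilde δ n, ∀ mt : ℂ, 0 ≤ mt.im →
            mt = GaussFC.s ((z : ℂ) + mt) + ε n →
              ‖GaussFC.m z - mt‖ ≤ C * ‖ε n‖ := by
  obtain ⟨A, hA, stab⟩ := GaussFC.exists_stability
  -- The 2 is the stability factor; `exp (A ^ 2)` forces `log n ≥ A ^ 2`.
  refine ⟨max 2 (Real.exp (A ^ 2)), by positivity, fun ε hε _ n hn z hz mt hmt heq => ?_⟩
  have hlog : A ^ 2 ≤ Real.log n := by
    have hlt : Real.exp (A ^ 2) < n := (le_max_right _ _).trans_lt hn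
    exact (Real.le_log_iff_exp_le ((Real.exp_pos _).trans hlt)).mpr hlt.le
  have hre : A ≤ z.re := by
    refine le_trans (Real.le_sqrt_of_sq_le ?_) hz.1
    -- As `δ < 1`, `(2 - δ) log n ≥ log n ≥ A ^ 2`.
    nlinarith [hδ.2, sq_nonneg A]
  refine (stab z (ε n) mt hre (hε n) hmt heq).trans ?_
  exact mul_le_mul_of_nonneg_right (le_max_left _ _) (norm_nonneg _)
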